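/- Let $k\ge 2$, let $\mathsf A=(A_1,\dots,A_k)\in \mathrm{GL}(2,\mathbb R)^k$, let $T$ be the shift on $\Omega=\{1,\dots,k\}^{\mathbb Z}$ (with the product topology), and for $\omega\in\Omega$, $n\ge 0$ put $A(\omega)=A_{\omega_0}$ and $A^{(n)}(\omega)=A_{\omega_{n-1}}\cdots A_{\omega_0}$. Suppose that the one-step cocycle $(T,A)$ is dominated, i.e. for every $\omega\in\Omega$ there is a splitting $\mathbb R^2=e_1(\omega)\oplus e_2(\omega)$ into one-dimensional subspaces such that $A(\omega)(e_i(\omega))=e_i(T\omega)$ for all $\omega$ and $i=1,2$, and there are constants $c>0$, $\delta>0$ with $$\frac{\|A^{(n)}(\omega)|e_1(\omega)\|}{\|A^{(n)}(\omega)|e_2(\omega)\|}\ge c\,e^{\delta n}\qquad\text{for all }\omega\in\Omega,\ n\ge 1 .$$ Let $\mathcal M$ be the set of $T$-invariant Borel probability measures on $\Omega$. For $\mu\in\mathcal M$ let $\lambda_1(\mu)=\int\lambda_1(\omega)\,d\mu(\omega)$, where $\lambda_1(\omega)=\lim_{n\to\infty}\frac1n\log\|A^{(n)}(\omega)\|$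 (with $\|\cdot\|$ the Euclidean operator norm), a limit that exists for $\mu$-almost every $\omega$. Put $\lambda_1^\top=\sup_{\mu\in\mathcal M}\lambda_1(\mu)$ and $\lambda_1^\bot=\inf_{\mu\in\mathcal M}\lambda_1(\mu)$, and for each $\star\in\{\top,\bot\}$ let $K^\star$ be the union of the supports of all measures $\mu\in\mathcal M$ with $\lambda_1(\mu)=\lambda_1^\star$. Then, for each $\star\in\{\top,\bot\}$: 1. $K^\star$ is a nonempty compact set with $T(K^\star)=K^\star$; 2. every $\mu\in\mathcal M$ whose support is contained in $K^\star$ satisfies $\lambda_1(\mu)=\lambda_1^\star$. -/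

import Mathlib

open MeasureTheory Filter Topology

noncomputable section

namespace MatrixCocycle

/-- The Euclidean plane. -/
abbrev Plane : Type := EuclideanSpace ℝ (Fin 2)

/-- The action of an invertible matrix on the Euclidean plane; its norm is the Euclidean operator
norm of the matrix. -/
def toMap (g : GL (Fin 2) ℝ) : Plane →L[ℝ] Plane :=
  Matrix.toEuclideanCLM (n := Fin 2) (𝕜 := ℝ) (g : Matrix (Fin 2) (Fin 2) ℝ)

section General

variable {Ω : Type*} (T : Ω → Ω) (A : Ω → GL (Fin 2) ℝ)

/-- The products `A⁽ⁿ⁾(ω) = A(Tⁿ⁻¹ω) ⋯ A(Tω) A(ω)`. -/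
def iterate : ℕ → Ω → GL (Fin 2) ℝ
  | 0, _ => 1
  | n + 1, ω => A (T^[n] ω) * iterate n ω

/-- `e₁ ⊕ e₂` is a dominated splitting for the cocycle `(T, A)`: at every point, `ℝ²` is the direct
sum of the lines `e₁ ω` and `e₂ ω`; the splitting is equivariant; and
`‖A⁽ⁿ⁾(ω) | e₁(ω)‖ / ‖A⁽ⁿ⁾(ω) | e₂(ω)‖ ≥ c e^{δ n}` for all `ω` and all `n ≥ 1`, where `c, δ > 0`
are constants. -/
structure IsDominatedSplitting (e₁ e₂ : Ω → Submodule ℝ Plane) : Prop where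
  finrank_fst : ∀ ω, Module.finrank ℝ (e₁ ω) = 1
  finrank_snd : ∀ ω, Module.finrank ℝ (e₂ ω) = 1
  isCompl : ∀ ω, IsCompl (e₁ ω) (e₂ ω)
  map_fst : ∀ ω, (e₁ ω).map (toMap (A ω)).toLinearMap = e₁ (T ω)
  map_snd : ∀ ω, (e₂ ω).map (toMap (A ω)).toLinearMap = e₂ (T ω)
  dominance : ∃ c > (0 : ℝ), ∃ δ > (0 : ℝ), ∀ (ω : Ω) (n : ℕ), 1 ≤ n →
    c * Real.exp (δ * n) ≤
      ‖(toMap (iterate T A n ω)).comp (e₁ ω).subtypeL‖ /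
        ‖(toMap (iterate T A n ω)).comp (e₂ ω).subtypeL‖

/-- A cocycle is dominated if it admits a dominated splitting. -/
def IsDominated : Prop :=
  ∃ e₁ e₂ : Ω → Submodule ℝ Plane, IsDominatedSplitting T A e₁ e₂

/-- The first Lyapunov exponent at a point,
`λ₁(A, ω) = lim (1/n) log ‖A⁽ⁿ⁾(ω)‖`. (The value at points where the limit does not exist is
immaterial: these points form a null set for every invariant probability measure.) -/
def lyapunovAt (ω : Ω) : ℝ :=
  limUnder atTop fun n : ℕ => (1 / (n : ℝ)) * Real.log ‖toMap (iterate T A n ω)‖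

variable [MeasurableSpace Ω]

/-- The set of `T`-invariant probability measures. -/
def invariantMeasures : Set (Measure Ω) :=
  {μ | IsProbabilityMeasure μ ∧ MeasurePreserving T μ μ}

/-- The first Lyapunov exponent of a measure, `λ₁(A, μ) = ∫ λ₁(A, ω) dμ(ω)`. -/
def lyapunov (μ : Measure Ω) : ℝ := ∫ ω, lyapunovAt T A ω ∂μ

/-- The maximal first Lyapunov exponent `λ₁^⊤`. -/
def topLyapunov : ℝ := sSup (lyapunov T A '' invariantMeasures T)

/-- The minimal first Lyapunov exponent `λ₁^⊥`. -/
def botLyapunov : ℝ := sInf (lyapunov T A '' invariantMeasures T)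

variable [TopologicalSpace Ω]

/-- The union of the supports of all invariant probability measures `μ` with `λ₁(μ) = λ₁^⊤`. -/
def upperMatherSet : Set Ω :=
  ⋃ μ ∈ {μ ∈ invariantMeasures T | lyapunov T A μ = topLyapunov T A}, μ.support

/-- The union of the supports of all invariant probability measures `μ` with `λ₁(μ) = λ₁^⊥`. -/
def lowerMatherSet : Set Ω :=
  ⋃ μ ∈ {μ ∈ invariantMeasures T | lyapunov T A μ = botLyapunov T A}, μ.support

end General

/-- The space of bi-infinite words on `k` symbols, with the product topology and the product
`σ`-algebra (which is its Borel `σ`-algebra). -/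
abbrev Words (k : ℕ) : Type := ℤ → Fin k

/-- The shift transformation. -/
def shift {k : ℕ} (ω : Words k) : Words k := fun i => ω (i + 1)

/-- The one-step cocycle map generated by a tuple of matrices: `A(ω) = A_{ω₀}`. -/
def oneStep {k : ℕ} (A : Fin k → GL (Fin 2) ℝ) (ω : Words k) : GL (Fin 2) ℝ := A (ω 0)

end MatrixCocycle

end

/-!
The proof rests on one property of the functions `G n ω = log ‖A⁽ⁿ⁾(ω)‖`: they form an *almost
additive* sequence, `|G (m + n) ω - G m ω - G n (Tᵐ ω)| ≤ C`. Domination gives this directly. At a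
fixed time the line `e₁` is expanded at least twice as much as `e₂`, which keeps the angle between
the two lines away from zero (`exists_norm_fst_le`); hence `‖A⁽ⁿ⁾(ω)‖` is comparable to
`‖A⁽ⁿ⁾(ω) | e₁(ω)‖`, and the latter is multiplicative (`exists_isAlmostAdditive`). No continuity of
the splitting is needed.

For an almost additive sequence, a maximal ergodic argument shows that `G n / n` converges almost
everywhere (`IsAlmostAdditive.ae_tendsto`), so that the exponent `Λ` satisfies
`|∫ G n dμ - n Λ(μ)| ≤ C` for every invariant probability measure
(`IsAlmostAdditive.abs_integral_sub_le`). In particular `Λ` is a uniform limit of weak-* continuous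
functions, and its maximum `β` is attained.

Since every finite word extends to a periodic one, invariant measures on periodic orbits give
`G n ≤ n β + C` everywhere. Conversely, let `μ` be maximizing. If `G n < n β - (3 C + 1)` on a set of
positive measure, orbits would visit that set linearly often, each visit at times in `n ℕ` costing
at least `1`, and `Λ(μ)` would be less than `β` (`IsAlmostAdditive.ae_ge_of_exponent_eq`). As `G n` is
continuous, `|G n - n β| ≤ 3 C + 1` holds on the whole support of `μ`, and therefore any invariant
measure carried by that support has exponent `β`: this replaces the continuous sub-action of the
usual subordination principle. Finally, the union of all supports of maximizing measures is the
support of one of them (`IsExponent.exists_support_eq_iUnion`), hence compact and invariant. The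
minimizing measures are handled by passing to `-G`.
-/

namespace MatrixCocycle

/-! ### Almost additive sequences -/

section AlmostAdditive

variable {Ω : Type*}

/-- `G` is an almost additive sequence of functions over the map `T`, with additive error `C`. -/
def IsAlmostAdditive (T : Ω → Ω) (C : ℝ) (G : ℕ → Ω → ℝ) : Prop :=
  ∀ m n ω, |G (m + n) ω - G m ω - G n (T^[m] ω)| ≤ C

variable {T : Ω → Ω} {C B : ℝ} {G : ℕ → Ω → ℝ}

lemma IsAlmostAdditive.neg (hG : IsAlmostAdditive T C G) :
    IsAlmostAdditive T C fun n ω => -G n ω := fun m n ω => by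
  rw [← abs_neg]
  convert! hG m n ω using 2
  ring

lemma IsAlmostAdditive.abs_apply_le (hG : IsAlmostAdditive T C G) (hB : ∀ ω, |G 1 ω| ≤ B) (n : ℕ)
    (ω : Ω) : |G n ω| ≤ C + n * (B + C) := by
  induction n with
  | zero =>
    have := hG 0 0 ω
    simp only [add_zero, Function.iterate_zero, id_eq, sub_self, zero_sub, abs_neg] at this
    simpa using this
  | succ n ih =>
    have h1 := hG n 1 ω
    have h2 := hB (T^[n] ω)
    rw [abs_le] at *
    push_cast
    constructor <;> linarith

lemma IsAlmostAdditive.abs_average_le (hG : IsAlmostAdditive T C G) (hB : ∀ ω, |G 1 ω| ≤ B) (n : ℕ)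
    (ω : Ω) : |1 / (n : ℝ) * G n ω| ≤ C + (B + C) := by
  have hC : 0 ≤ C := (abs_nonneg _).trans (hG 0 0 ω)
  have hB0 : 0 ≤ B := (abs_nonneg _).trans (hB ω)
  rcases Nat.eq_zero_or_pos n with rfl | hn
  · simp only [Nat.cast_zero, div_zero, zero_mul, abs_zero]
    linarith
  · have hn' : (1 : ℝ) ≤ n := by exact_mod_cast hn
    rw [abs_mul, abs_of_nonneg (by positivity), one_div, inv_mul_le_iff₀ (by linarith)]
    have := hG.abs_apply_le hB n ω
    nlinarith

lemma IsAlmostAdditive.nonneg [Nonempty Ω] (hG : IsAlmostAdditive T C G) : 0 ≤ C :=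
  (abs_nonneg _).trans (hG 0 0 (Classical.arbitrary Ω))

/-- Up to an error `C` per step and a bounded error, the values of an almost additive sequence are
Birkhoff sums of `G N / N`: since `G N ∘ T^[i]` is within `C` of `G (i + N) - G i`, the Birkhoff sum
telescopes. -/
lemma IsAlmostAdditive.exists_abs_birkhoffSum_sub_le (hG : IsAlmostAdditive T C G)
    (hB : ∀ ω, |G 1 ω| ≤ B) (N : ℕ) :
    ∃ D, ∀ n ω, |birkhoffSum T (G N) n ω - N * G n ω| ≤ n * C + D := by
  have key : ∀ n ω, |birkhoffSum T (G N) n ω -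
      (∑ j ∈ Finset.range N, G (n + j) ω - ∑ j ∈ Finset.range N, G j ω)| ≤ n * C := by
    intro n ω
    induction n with
    | zero => simp
    | succ n ih =>
      have h1 : ∑ j ∈ Finset.range N, G (n + 1 + j) ω =
          ∑ j ∈ Finset.range N, G (n + j) ω + G (n + N) ω - G n ω := by
        have := Finset.sum_range_succ (fun j => G (n + j) ω) N
        rw [Finset.sum_range_succ'] at this
        simp only [add_zero] at this
        rw [← this, add_sub_cancel_right]
        exact Finset.sum_congr rfl fun j _ => by rw [add_right_comm, add_assoc]
      have h2 := hG n N ω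
      rw [birkhoffSum_succ, h1]
      rw [abs_le] at *
      push_cast
      constructor <;> linarith
  refine ⟨∑ j ∈ Finset.range N, (C + 2 * (C + j * (B + C))), fun n ω => ?_⟩
  have h3 : |∑ j ∈ Finset.range N, (G (n + j) ω - G j ω - G n ω)| ≤
      ∑ j ∈ Finset.range N, (C + 2 * (C + j * (B + C))) := by
    refine (Finset.abs_sum_le_sum_abs _ _).trans (Finset.sum_le_sum fun j _ => ?_)
    have h1 := hG n j ω
    have h2 := hG.abs_apply_le hB j ω
    have h4 := hG.abs_apply_le hB j (T^[n] ω)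
    rw [abs_le] at *
    constructor <;> linarith
  have h5 := key n ω
  simp only [Finset.sum_sub_distrib, Finset.sum_const, Finset.card_range, nsmul_eq_mul] at h3
  rw [abs_le] at *
  constructor <;> linarith

lemma IsAlmostAdditive.unbounded_above_iff (hG : IsAlmostAdditive T C G) (hB : ∀ ω, |G 1 ω| ≤ B)
    (b : ℝ) (ω : Ω) :
    (∀ K : ℕ, ∃ n : ℕ, b * n + K < G n (T ω)) ↔ ∀ K : ℕ, ∃ n : ℕ, b * n + K < G n ω := by
  have hstep : ∀ n : ℕ, |G (n + 1) ω - G n (T ω)| ≤ C + B := fun n => by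
    have h1 := hG 1 n ω
    have h2 := hB ω
    rw [add_comm 1 n, Function.iterate_one] at h1
    rw [abs_le] at *
    constructor <;> linarith
  constructor
  · intro h K
    obtain ⟨L, hL⟩ := exists_nat_ge (K + C + B + |b|)
    obtain ⟨n, hn⟩ := h L
    refine ⟨n + 1, ?_⟩
    have := (abs_le.mp (hstep n)).1
    have := le_abs_self b
    push_cast
    linarith
  · intro h K
    obtain ⟨L, hL⟩ := exists_nat_ge (K + C + B + |b| + |G 0 ω|)
    obtain ⟨n, hn⟩ := h L
    rcases n with _ | n
    · have h1 := le_abs_self (G 0 ω)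
      have h2 := abs_nonneg b
      have h3 := (abs_nonneg _).trans (hstep 0)
      have : (0 : ℝ) ≤ K := K.cast_nonneg
      simp only [Nat.cast_zero, mul_zero] at hn
      linarith
    · refine ⟨n, ?_⟩
      have := (abs_le.mp (hstep n)).2
      have := neg_abs_le b
      have := abs_nonneg (G 0 ω)
      push_cast at hn
      linarith

/-- The set where `G n - b n` is unbounded above and `G n - a n` is unbounded below. Unlike the set
where the averages of `G` oscillate across `[a, b]`, it is exactly invariant under `T`. -/
def oscillationSet (G : ℕ → Ω → ℝ) (a b : ℝ) : Set Ω :=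
  {ω | (∀ K : ℕ, ∃ n : ℕ, b * n + K < G n ω) ∧ ∀ K : ℕ, ∃ n : ℕ, G n ω < a * n - K}

lemma IsAlmostAdditive.preimage_oscillationSet (hG : IsAlmostAdditive T C G)
    (hB : ∀ ω, |G 1 ω| ≤ B) (a b : ℝ) : T ⁻¹' oscillationSet G a b = oscillationSet G a b := by
  ext ω
  refine and_congr (hG.unbounded_above_iff hB b ω) ?_
  have := hG.neg.unbounded_above_iff (B := B) (by simpa using hB) (-a) ω
  have hneg : ∀ (K n : ℕ) (x : ℝ), -a * n + K < -x ↔ x < a * n - K := fun K n x => by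
    constructor <;> intro h <;> linarith
  simpa only [hneg] using this

/-- Each visit to a set where `G n - n β` is very negative costs at least `1`, and in between
`G` grows at rate at most `β`. -/
lemma IsAlmostAdditive.le_sub_birkhoffSum_indicator (hG : IsAlmostAdditive T C G)
    {β : ℝ}
    (hup : ∀ n ω, G n ω ≤ n * β + C) (n M l : ℕ) (ω : Ω) :
    G (l + M * n) ω ≤ (l + M * n) * β + C - birkhoffSum T^[n]
      ({ω | G n ω < n * β - (3 * C + 1)}.indicator 1) M (T^[l] ω) := by
  set E : Set Ω := {ω | G n ω < n * β - (3 * C + 1)} with hE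
  induction M generalizing l ω with
  | zero => simpa using hup l ω
  | succ M ih =>
    rw [birkhoffSum_succ', ← Function.iterate_add_apply, add_comm n l]
    by_cases hω : T^[l] ω ∈ E
    · have h0 : G n (T^[l] ω) < n * β - (3 * C + 1) := hω
      have h1 := (abs_le.mp (hG l (n + M * n) ω)).2
      have h2 := (abs_le.mp (hG n (M * n) (T^[l] ω))).2
      have h3 := ih 0 (T^[l + n] ω)
      have h4 := hup l ω
      rw [← Function.iterate_add_apply, add_comm n l] at h2
      simp only [zero_add, Nat.cast_zero, Function.iterate_zero, id] at h3
      rw [show (M + 1) * n = n + M * n by ring, Set.indicator_of_mem hω, Pi.one_apply]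
      push_cast
      linarith
    · have h1 := ih (l + n) ω
      rw [show l + (M + 1) * n = l + n + M * n by ring, Set.indicator_of_notMem hω, zero_add]
      push_cast at h1 ⊢
      linarith

end AlmostAdditive

/-! ### The ergodic theorem for almost additive sequences -/

section Ergodic

variable {Ω : Type*} {T : Ω → Ω}

/-- The maximum of `0` and the first `N` Birkhoff sums of `φ`, in recursive form. -/
def maxBirkhoffSum (T : Ω → Ω) (φ : Ω → ℝ) : ℕ → Ω → ℝ
  | 0, _ => 0
  | N + 1, ω => max 0 (φ ω + maxBirkhoffSum T φ N (T ω))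

lemma maxBirkhoffSum_le_succ (φ : Ω → ℝ) (N : ℕ) (ω : Ω) :
    maxBirkhoffSum T φ N ω ≤ maxBirkhoffSum T φ (N + 1) ω := by
  induction N generalizing ω with
  | zero => exact le_max_left _ _
  | succ N ih => exact max_le_max le_rfl (add_le_add le_rfl (ih _))

lemma maxBirkhoffSum_nonneg (φ : Ω → ℝ) (N : ℕ) (ω : Ω) : 0 ≤ maxBirkhoffSum T φ N ω := by
  cases N with
  | zero => exact le_rfl
  | succ N => exact le_max_left _ _

lemma birkhoffSum_le_maxBirkhoffSum (φ : Ω → ℝ) (N : ℕ) (ω : Ω) :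
    birkhoffSum T φ N ω ≤ maxBirkhoffSum T φ N ω := by
  induction N generalizing ω with
  | zero => simp [maxBirkhoffSum]
  | succ N ih =>
    rw [birkhoffSum_succ']
    exact (add_le_add le_rfl (ih _)).trans (le_max_right _ _)

variable [MeasurableSpace Ω] {μ : Measure Ω}

lemma integrable_maxBirkhoffSum (hT : MeasurePreserving T μ μ) {φ : Ω → ℝ} (hφ : Integrable φ μ)
    (N : ℕ) : Integrable (maxBirkhoffSum T φ N) μ := by
  induction N with
  | zero => exact integrable_zero _ _ _
  | succ N ih => exact (integrable_zero Ω ℝ μ).sup (hφ.add (hT.integrable_comp_of_integrable ih))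

lemma measurable_maxBirkhoffSum (hT : Measurable T) {φ : Ω → ℝ} (hφ : Measurable φ) (N : ℕ) :
    Measurable (maxBirkhoffSum T φ N) := by
  induction N with
  | zero => exact measurable_const
  | succ N ih => exact measurable_const.max (hφ.add (ih.comp hT))

/-- The maximal ergodic theorem: a function has nonnegative integral if almost every point has a
positive Birkhoff sum. -/
lemma integral_nonneg_of_birkhoffSum_pos (hT : MeasurePreserving T μ μ) {φ : Ω → ℝ}
    (hφm : Measurable φ) (hφ : Integrable φ μ)
    (h : ∀ᵐ ω ∂μ, ∃ n, 0 < birkhoffSum T φ n ω) : 0 ≤ ∫ ω, φ ω ∂μ := by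
  set M := maxBirkhoffSum T φ with hM
  have hMi := integrable_maxBirkhoffSum hT hφ
  have hMm := measurable_maxBirkhoffSum hT.measurable hφm
  have hmono : ∀ ω, Monotone fun N => M N ω := fun ω =>
    monotone_nat_of_le_succ fun N => maxBirkhoffSum_le_succ φ N ω
  let P : ℕ → Set Ω := fun N => {ω | 0 < M N ω}
  have hP : ∀ N, MeasurableSet (P N) := fun N => measurableSet_lt measurable_const (hMm N)
  have hPmono : Monotone P := fun a b hab ω hω => lt_of_lt_of_le hω (hmono ω hab)
  have hstep : ∀ N, 0 ≤ ∫ ω in P (N + 1), φ ω ∂μ := by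
    intro N
    have hcomp : Integrable (fun ω => M N (T ω)) μ := hT.integrable_comp_of_integrable (hMi N)
    have h1 : ∫ ω in P (N + 1), φ ω ∂μ =
        ∫ ω in P (N + 1), M (N + 1) ω ∂μ - ∫ ω in P (N + 1), M N (T ω) ∂μ := by
      rw [← integral_sub (hMi _).integrableOn hcomp.integrableOn]
      refine setIntegral_congr_fun (hP _) fun ω hω => ?_
      have hω' : 0 < max 0 (φ ω + M N (T ω)) := hω
      have h2 : M (N + 1) ω = φ ω + M N (T ω) := max_eq_right (by
        by_contra hneg
        rw [max_eq_left (not_le.mp hneg).le] at hω'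
        exact lt_irrefl _ hω')
      change φ ω = M (N + 1) ω - M N (T ω)
      rw [h2, add_sub_cancel_right]
    have h2 : ∫ ω in P (N + 1), M (N + 1) ω ∂μ = ∫ ω, M (N + 1) ω ∂μ :=
      setIntegral_eq_integral_of_forall_compl_eq_zero fun ω hω =>
        le_antisymm (not_lt.mp hω) (maxBirkhoffSum_nonneg _ _ _)
    have h3 : ∫ ω in P (N + 1), M N (T ω) ∂μ ≤ ∫ ω, M N (T ω) ∂μ :=
      setIntegral_le_integral hcomp (Eventually.of_forall fun ω => maxBirkhoffSum_nonneg _ _ _)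
    have h4 : ∫ ω, M N (T ω) ∂μ = ∫ ω, M N ω ∂μ := by
      have := integral_map (μ := μ) hT.measurable.aemeasurable
        (f := M N) (hMm N).aestronglyMeasurable
      rw [hT.map_eq] at this
      exact this.symm
    have h5 : ∫ ω, M N ω ∂μ ≤ ∫ ω, M (N + 1) ω ∂μ :=
      integral_mono (hMi _) (hMi _) fun ω => maxBirkhoffSum_le_succ φ N ω
    linarith
  have hlim := tendsto_setIntegral_of_monotone hP hPmono hφ.integrableOn
  have hfull : ∫ ω in ⋃ N, P N, φ ω ∂μ = ∫ ω, φ ω ∂μ := by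
    have : (⋃ N, P N : Set Ω) =ᵐ[μ] Set.univ := by
      rw [ae_eq_univ]
      refine measure_mono_null (fun ω hω => ?_) h
      rintro ⟨n, hn⟩
      exact hω (Set.mem_iUnion.mpr ⟨n, hn.trans_le (birkhoffSum_le_maxBirkhoffSum _ _ _)⟩)
    rw [setIntegral_congr_set this, setIntegral_univ]
  rw [hfull] at hlim
  refine ge_of_tendsto hlim ?_
  filter_upwards [eventually_ge_atTop 1] with N hN
  obtain ⟨N, rfl⟩ := Nat.exists_eq_add_of_le' hN
  exact hstep N

variable [IsFiniteMeasure μ]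

lemma measurableSet_oscillationSet {G : ℕ → Ω → ℝ} (hG : ∀ n, Measurable (G n)) (a b : ℝ) :
    MeasurableSet (oscillationSet G a b) := by
  simp only [oscillationSet, Set.ofPred_and, Set.ofPred_forall, Set.ofPred_exists]
  exact (MeasurableSet.iInter fun K => MeasurableSet.iUnion fun n =>
    measurableSet_lt measurable_const (hG n)).inter
    (MeasurableSet.iInter fun K => MeasurableSet.iUnion fun n =>
    measurableSet_lt (hG n) measurable_const)

variable {C B : ℝ} {G : ℕ → Ω → ℝ}

/-- If `G n - b n` is almost everywhere unbounded above, then `G N` has average at least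
`b N - C`. -/
lemma IsAlmostAdditive.le_integral_of_unbounded (hT : MeasurePreserving T μ μ)
    (hG : IsAlmostAdditive T C G) (hB : ∀ ω, |G 1 ω| ≤ B) (hm : ∀ n, Measurable (G n)) {b : ℝ}
    (h : ∀ᵐ ω ∂μ, ∀ K : ℕ, ∃ n : ℕ, b * n + K < G n ω) {N : ℕ} (hN : 1 ≤ N) :
    (b * N - C) * μ.real Set.univ ≤ ∫ ω, G N ω ∂μ := by
  have hint : Integrable (G N) μ := .of_bound (hm N).aestronglyMeasurable (C + N * (B + C))
    (Eventually.of_forall fun ω => hG.abs_apply_le hB N ω)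
  obtain ⟨D, hD⟩ := hG.exists_abs_birkhoffSum_sub_le hB N
  have key := integral_nonneg_of_birkhoffSum_pos hT (φ := fun ω => G N ω - (b * N - C))
    ((hm N).sub measurable_const) (hint.sub (integrable_const _)) ?_
  · rw [integral_sub hint (integrable_const _), integral_const, smul_eq_mul] at key
    linarith
  · filter_upwards [h] with ω hω
    obtain ⟨K, hK⟩ := exists_nat_ge |D|
    obtain ⟨n, hn⟩ := hω K
    refine ⟨n, ?_⟩
    have h1 := (abs_le.mp (hD n ω)).1
    have h2 : birkhoffSum T (fun ω => G N ω - (b * N - C)) n ω =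
        birkhoffSum T (G N) n ω - n * (b * N - C) := by
      simp only [birkhoffSum, Finset.sum_sub_distrib, Finset.sum_const, Finset.card_range,
        nsmul_eq_mul]
      ring
    have h3 := le_abs_self D
    have h4 : (K : ℝ) ≤ N * K := le_mul_of_one_le_left K.cast_nonneg (by exact_mod_cast hN)
    have h5 : (N : ℝ) * (b * n + K) < N * G n ω :=
      mul_lt_mul_of_pos_left hn (by exact_mod_cast hN)
    rw [h2]
    nlinarith

/-- The maximal ergodic theorem on the invariant set `oscillationSet G a b`, applied to `G N` from
above and from below, would give `b - a ≤ 2 C / N` for all `N` if that set had positive measure. -/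
lemma IsAlmostAdditive.measure_oscillationSet (hT : MeasurePreserving T μ μ)
    (hG : IsAlmostAdditive T C G) (hB : ∀ ω, |G 1 ω| ≤ B) (hm : ∀ n, Measurable (G n)) {a b : ℝ}
    (hab : a < b) : μ (oscillationSet G a b) = 0 := by
  set E := oscillationSet G a b with hE
  have hEm : MeasurableSet E := measurableSet_oscillationSet hm a b
  have hTE : MeasurePreserving T (μ.restrict E) (μ.restrict E) := by
    have := hT.restrict_preimage hEm
    rwa [hG.preimage_oscillationSet hB] at this
  have h1 := fun N (hN : 1 ≤ N) => hG.le_integral_of_unbounded hTE hB hm (b := b)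
    ((ae_restrict_iff' hEm).mpr (Eventually.of_forall fun ω hω => hω.1)) hN
  have h2 := fun N (hN : 1 ≤ N) => hG.neg.le_integral_of_unbounded hTE (B := B) (by simpa using hB)
    (fun n => (hm n).neg) (b := -a)
    ((ae_restrict_iff' hEm).mpr (Eventually.of_forall fun ω hω K => by
      obtain ⟨n, hn⟩ := hω.2 K
      exact ⟨n, by linarith⟩)) hN
  by_contra hpos
  have hr : 0 < (μ.restrict E).real Set.univ := by
    rw [measureReal_def, Measure.restrict_apply_univ]
    exact ENNReal.toReal_pos hpos (measure_ne_top _ _)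
  obtain ⟨N, hN⟩ := exists_nat_gt (max 1 (2 * C / (b - a)))
  have hN1 : 1 ≤ N := by exact_mod_cast ((le_max_left _ _).trans hN.le)
  have hN2 : 2 * C < N * (b - a) := (div_lt_iff₀ (by linarith)).mp ((le_max_right _ _).trans_lt hN)
  have h3 := h1 N hN1
  have h4 := h2 N hN1
  rw [integral_neg] at h4
  nlinarith

/-- The averages of an almost additive sequence of bounded measurable functions converge almost
everywhere. -/
theorem IsAlmostAdditive.ae_tendsto (hT : MeasurePreserving T μ μ)
    (hG : IsAlmostAdditive T C G) (hB : ∀ ω, |G 1 ω| ≤ B) (hm : ∀ n, Measurable (G n)) :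
    ∀ᵐ ω ∂μ, ∃ l : ℝ, Tendsto (fun n : ℕ => (1 / (n : ℝ)) * G n ω) atTop (𝓝 l) := by
  have h0 : ∀ᵐ ω ∂μ, ∀ q : ℚ × ℚ, q.1 < q.2 → ω ∉ oscillationSet G q.1 q.2 := by
    rw [ae_all_iff]
    intro q
    by_cases hq : q.1 < q.2
    · have := hG.measure_oscillationSet hT hB hm (a := q.1) (b := q.2) (by exact_mod_cast hq)
      filter_upwards [measure_eq_zero_iff_ae_notMem.mp this] with ω hω _ using hω
    · exact Eventually.of_forall fun ω h => absurd h hq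
  filter_upwards [h0] with ω hω
  have hbd := fun n => hG.abs_average_le hB n ω
  refine tendsto_of_no_upcrossings dense_univ (fun a _ b _ hab hfreq => ?_)
    (isBoundedUnder_of ⟨C + (B + C), fun n => (abs_le.mp (hbd n)).2⟩)
    (isBoundedUnder_of ⟨-(C + (B + C)), fun n => (abs_le.mp (hbd n)).1⟩)
  obtain ⟨a', haa, hab'⟩ := exists_rat_btwn hab
  obtain ⟨b', hab'', hbb⟩ := exists_rat_btwn hab'
  refine hω (a', b') (by exact_mod_cast hab'') ⟨fun K => ?_, fun K => ?_⟩
  · obtain ⟨L, hL⟩ := exists_nat_gt (max 1 (K / (b - b')))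
    obtain ⟨n, hn, hLn⟩ := (hfreq.2.and_eventually (eventually_ge_atTop L)).exists
    have hLn' : (L : ℝ) ≤ n := by exact_mod_cast hLn
    have h1 : (0 : ℝ) < n := by linarith [(le_max_left _ _).trans_lt hL]
    have h2 : (K : ℝ) < L * (b - b') :=
      (div_lt_iff₀ (by linarith)).mp ((le_max_right _ _).trans_lt hL)
    refine ⟨n, ?_⟩
    rw [one_div, inv_mul_eq_div, lt_div_iff₀ h1] at hn
    simp only
    nlinarith
  · obtain ⟨L, hL⟩ := exists_nat_gt (max 1 (K / (a' - a)))
    obtain ⟨n, hn, hLn⟩ := (hfreq.1.and_eventually (eventually_ge_atTop L)).exists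
    have hLn' : (L : ℝ) ≤ n := by exact_mod_cast hLn
    have h1 : (0 : ℝ) < n := by linarith [(le_max_left _ _).trans_lt hL]
    have h2 : (K : ℝ) < L * (a' - a) :=
      (div_lt_iff₀ (by linarith)).mp ((le_max_right _ _).trans_lt hL)
    refine ⟨n, ?_⟩
    rw [one_div, inv_mul_eq_div, div_lt_iff₀ h1] at hn
    simp only
    nlinarith

/-- The integrals of an almost additive sequence against an invariant probability measure stay
within `C` of the multiples of the integral of its asymptotic average. -/
theorem IsAlmostAdditive.abs_integral_sub_le (hμ : IsProbabilityMeasure μ)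
    (hT : MeasurePreserving T μ μ)
    (hG : IsAlmostAdditive T C G) (hB : ∀ ω, |G 1 ω| ≤ B) (hm : ∀ n, Measurable (G n)) (n : ℕ) :
    |∫ ω, G n ω ∂μ - n * ∫ ω, limUnder atTop (fun n : ℕ => (1 / (n : ℝ)) * G n ω) ∂μ| ≤ C := by
  have : Nonempty Ω := nonempty_of_isProbabilityMeasure μ
  have hC := hG.nonneg
  have hint : ∀ N, Integrable (G N) μ := fun N =>
    .of_bound (hm N).aestronglyMeasurable (C + N * (B + C))
      (Eventually.of_forall fun ω => hG.abs_apply_le hB N ω)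
  have hadd : ∀ m n, |∫ ω, G (m + n) ω ∂μ - ∫ ω, G m ω ∂μ - ∫ ω, G n ω ∂μ| ≤ C := by
    intro m n
    have hTm := hT.iterate m
    have h4 : ∫ ω, G n (T^[m] ω) ∂μ = ∫ ω, G n ω ∂μ := by
      have := integral_map (μ := μ) hTm.measurable.aemeasurable
        (f := G n) (hm n).aestronglyMeasurable
      rw [hTm.map_eq] at this
      exact this.symm
    have hcomp : Integrable (fun ω => G n (T^[m] ω)) μ :=
      hTm.integrable_comp_of_integrable (hint n)
    rw [← h4, ← integral_sub (hint _) (hint _),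
      ← integral_sub (by fun_prop (disch := exact hint _)) hcomp]
    have := norm_integral_le_of_norm_le_const (μ := μ) (C := C)
      (f := fun ω => G (m + n) ω - G m ω - G n (T^[m] ω)) (Eventually.of_forall fun ω => hG m n ω)
    simpa using this
  set x : ℕ → ℝ := fun n => ∫ ω, G n ω ∂μ with hx
  set L := ∫ ω, limUnder atTop (fun n : ℕ => (1 / (n : ℝ)) * G n ω) ∂μ with hL
  have hlim : Tendsto (fun n : ℕ => (1 / (n : ℝ)) * x n) atTop (𝓝 L) := by
    have : ∀ n : ℕ, 1 / (n : ℝ) * x n = ∫ ω, 1 / (n : ℝ) * G n ω ∂μ := fun n =>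
      (integral_const_mul _ _).symm
    simp only [this]
    refine tendsto_integral_of_dominated_convergence (fun _ => C + (B + C))
      (fun n => ((hm n).const_mul _).aestronglyMeasurable) (integrable_const _)
      (fun n => Eventually.of_forall fun ω => ?_) ?_
    · exact hG.abs_average_le hB n ω
    · filter_upwards [hG.ae_tendsto hT hB hm] with ω hω
      exact tendsto_nhds_limUnder hω
  have hmul : ∀ q : ℕ, |x (q * n) - q * x n| ≤ (q + 1) * C := by
    intro q
    induction q with
    | zero =>
      have := hadd 0 0
      simp only [add_zero, sub_self, zero_sub, abs_neg] at this
      simpa using this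
    | succ q ih =>
      have h1 := hadd (q * n) n
      rw [← Nat.succ_mul] at h1
      rw [abs_le] at *
      push_cast
      constructor <;> linarith
  rcases Nat.eq_zero_or_pos n with rfl | hn
  · simpa using hmul 0
  have hn' : (0 : ℝ) < n := by exact_mod_cast hn
  have hsub : Tendsto (fun q : ℕ => (1 / ((q * n : ℕ) : ℝ)) * x (q * n)) atTop (𝓝 L) :=
    hlim.comp (tendsto_id.atTop_mul_const' hn)
  have h1 : Tendsto (fun q : ℕ => |n * ((1 / ((q * n : ℕ) : ℝ)) * x (q * n)) - x n|) atTop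
      (𝓝 |n * L - x n|) := ((hsub.const_mul _).sub_const _).abs
  have h2 : Tendsto (fun q : ℕ => C + C * (1 / (q : ℝ))) atTop (𝓝 (C + C * 0)) :=
    (tendsto_one_div_atTop_nhds_zero_nat.const_mul C).const_add C
  have h3 := le_of_tendsto_of_tendsto h1 h2 (by
    filter_upwards [eventually_ge_atTop 1] with q hq
    have hq' : (0 : ℝ) < q := by exact_mod_cast hq
    have h4 : n * ((1 / ((q * n : ℕ) : ℝ)) * x (q * n)) - x n = (x (q * n) - q * x n) / q := by
      push_cast
      field_simp
    rw [h4, abs_div, abs_of_pos hq', div_le_iff₀ hq']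
    refine (hmul q).trans (le_of_eq ?_)
    field_simp)
  rw [abs_sub_comm]
  simpa using h3

end Ergodic

/-! ### Ergodic optimization of almost additive sequences -/

section Optimization

lemma le_of_forall_nat_mul_le {x y D : ℝ} (h : ∀ n : ℕ, n * x ≤ n * y + D) : x ≤ y := by
  by_contra! hxy
  obtain ⟨n, hn⟩ := exists_nat_gt (D / (x - y))
  have h1 := h n
  rw [div_lt_iff₀ (by linarith)] at hn
  linarith

variable {Ω : Type*} [MeasurableSpace Ω] {T : Ω → Ω} {C β : ℝ} {G : ℕ → Ω → ℝ}
  {Λ : Measure Ω → ℝ}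

/-- `Λ μ` is the asymptotic average of the integrals of `G n` against `μ`, for every invariant
probability measure `μ`, with error at most `C / n`; this determines `Λ μ`. -/
def IsExponent (T : Ω → Ω) (C : ℝ) (G : ℕ → Ω → ℝ) (Λ : Measure Ω → ℝ) : Prop :=
  ∀ μ ∈ invariantMeasures T, ∀ n : ℕ, |∫ ω, G n ω ∂μ - n * Λ μ| ≤ C

lemma IsExponent.neg (hΛ : IsExponent T C G Λ) :
    IsExponent T C (fun n ω => -G n ω) fun μ => -Λ μ := fun μ hμ n => by
  rw [integral_neg, ← abs_neg]
  convert! hΛ μ hμ n using 2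
  ring

/-- The invariant measure carried by a periodic orbit has an exponent at least `(G n p - C) / n`. -/
lemma IsExponent.exists_ge_of_isPeriodicPt (hT : Measurable T) (hG : IsAlmostAdditive T C G)
    (hm : ∀ n, Measurable (G n)) (hΛ : IsExponent T C G Λ) {n : ℕ} (hn : 0 < n) {p : Ω}
    (hp : Function.IsPeriodicPt T n p) : ∃ μ ∈ invariantMeasures T, G n p ≤ n * Λ μ + C := by
  have hn0 : (n : ENNReal) ≠ 0 := by exact_mod_cast hn.ne'
  have hnR : (0 : ℝ) < n := by exact_mod_cast hn
  set μ : Measure Ω := (n : ENNReal)⁻¹ • ∑ i ∈ Finset.range n, Measure.dirac (T^[i] p) with hμ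
  have hprob : IsProbabilityMeasure μ := ⟨by
    simp [hμ, ENNReal.inv_mul_cancel hn0 (ENNReal.natCast_ne_top n)]⟩
  have hmap : μ.map T = μ := by
    rw [hμ, Measure.map_smul, Measure.map_finset_sum hT.aemeasurable]
    congr 1
    simp only [Measure.map_dirac' hT, ← Function.iterate_succ_apply']
    have := Finset.sum_range_succ' (fun i => Measure.dirac (T^[i] p)) n
    rw [Finset.sum_range_succ, hp.eq, Function.iterate_zero, id] at this
    ext s hs
    have h1 := congrArg (fun m : Measure Ω => m s) this
    simp only [Measure.add_apply] at h1
    exact ((ENNReal.add_left_inj (measure_ne_top _ _)).mp h1).symm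
  have hint : ∀ m, ∫ ω, G m ω ∂μ = (n : ℝ)⁻¹ * ∑ i ∈ Finset.range n, G m (T^[i] p) := by
    intro m
    rw [hμ, integral_smul_measure, integral_finsetSum_measure]
    · simp only [integral_dirac' _ _ (hm m).stronglyMeasurable]
      simp
    · exact fun i _ => (integrable_dirac' (hm m).stronglyMeasurable (by simp))
  have hiter : ∀ m, T^[m * n] p = p := fun m => (hp.const_mul m).eq
  -- The extra `C` accounts for `G 0`, which need not vanish.
  have hmul : ∀ m : ℕ, m * G n p - (m + 1) * C ≤ G (m * n) p := by
    intro m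
    induction m with
    | zero =>
      have := (abs_le.mp (hG 0 0 p)).2
      simp only [add_zero, Function.iterate_zero, id_eq, sub_self, zero_sub] at this
      simp only [Nat.cast_zero, zero_mul]
      linarith
    | succ m ih =>
      have h1 := (abs_le.mp (hG (m * n) n p)).1
      rw [hiter, ← Nat.succ_mul] at h1
      push_cast
      linarith
  -- Compare `G (i + m n) p` with both ways of splitting off a segment of length `i`.
  have horbit : ∀ m i, G (m * n) p - 2 * C ≤ G (m * n) (T^[i] p) := by
    intro m i
    have h1 := (abs_le.mp (hG i (m * n) p)).2
    have h2 := (abs_le.mp (hG (m * n) i p)).1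
    rw [hiter, add_comm (m * n) i] at h2
    linarith
  have hinv : μ ∈ invariantMeasures T := ⟨hprob, hT, hmap⟩
  refine ⟨μ, hinv, ?_⟩
  suffices G n p - C ≤ n * Λ μ by linarith
  refine le_of_forall_nat_mul_le (D := 4 * C) fun m => ?_
  have h1 := (abs_le.mp (hΛ μ hinv (m * n))).2
  have h2 : G (m * n) p - 2 * C ≤ ∫ ω, G (m * n) ω ∂μ := by
    rw [hint, inv_mul_eq_div, le_div_iff₀ hnR, mul_comm]
    have := Finset.card_nsmul_le_sum (Finset.range n) (fun i => G (m * n) (T^[i] p)) _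
      fun i _ => horbit m i
    simpa using this
  have h3 := hmul m
  push_cast at h1
  linarith

/-- For a maximizing measure, `G n` almost surely stays above `n β` minus a constant: by invariance, a
set of positive measure where `G n` falls short of `n β` would be visited, on average, a number of
times growing linearly, and the exponent would be less than `β`. -/
lemma IsAlmostAdditive.ae_ge_of_exponent_eq {μ : Measure Ω} (hμ : μ ∈ invariantMeasures T)
    (hG : IsAlmostAdditive T C G) (hm : ∀ n, Measurable (G n)) (hint : ∀ n, Integrable (G n) μ)
    (hΛ : IsExponent T C G Λ) (hup : ∀ n ω, G n ω ≤ n * β + C) (hβ : Λ μ = β) (n : ℕ) :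
    ∀ᵐ ω ∂μ, n * β - (3 * C + 1) ≤ G n ω := by
  have := hμ.1
  set E : Set Ω := {ω | G n ω < n * β - (3 * C + 1)} with hE
  have hEm : MeasurableSet E := measurableSet_lt (hm n) measurable_const
  have hTi := fun j => (hμ.2.iterate n).iterate j
  have hI : Integrable (E.indicator (1 : Ω → ℝ)) μ := (integrable_const (1 : ℝ)).indicator hEm
  have hterm : ∀ j, Integrable (fun ω => E.indicator (1 : Ω → ℝ) ((T^[n])^[j] ω)) μ := fun j =>
    (hTi j).integrable_comp_of_integrable hI
  have hval : ∀ j, ∫ ω, E.indicator (1 : Ω → ℝ) ((T^[n])^[j] ω) ∂μ = μ.real E := fun j => by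
    have h1 := integral_map (μ := μ) (hTi j).measurable.aemeasurable
      (f := E.indicator (1 : Ω → ℝ)) ((hTi j).map_eq.symm ▸ hI.aestronglyMeasurable)
    rw [(hTi j).map_eq, integral_indicator_one hEm] at h1
    exact h1.symm
  have hle : ∀ M : ℕ, M * μ.real E ≤ M * 0 + 2 * C := by
    intro M
    have hsumI : Integrable (fun ω => birkhoffSum T^[n] (E.indicator (1 : Ω → ℝ)) M ω) μ :=
      integrable_finsetSum _ fun j _ => hterm j
    have h1 : ∫ ω, G (M * n) ω ∂μ ≤
        ∫ ω, (M * n * β + C - birkhoffSum T^[n] (E.indicator (1 : Ω → ℝ)) M ω) ∂μ :=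
      integral_mono (hint _) ((integrable_const _).sub hsumI) fun ω => by
        simpa using hG.le_sub_birkhoffSum_indicator hup n M 0 ω
    have h2 : ∫ ω, birkhoffSum T^[n] (E.indicator (1 : Ω → ℝ)) M ω ∂μ = M * μ.real E := by
      simp only [birkhoffSum]
      rw [integral_finsetSum _ fun j _ => hterm j]
      simp [hval]
    rw [integral_sub (integrable_const _) hsumI, h2] at h1
    have h3 := (abs_le.mp (hΛ μ hμ (M * n))).1
    rw [hβ] at h3
    simp only [integral_const, probReal_univ, smul_eq_mul, one_mul] at h1
    push_cast at h3
    linarith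
  have h0 : μ.real E = 0 := le_antisymm (le_of_forall_nat_mul_le hle) measureReal_nonneg
  have h1 : μ E = 0 := (measureReal_eq_zero_iff).mp h0
  filter_upwards [measure_eq_zero_iff_ae_notMem.mp h1] with ω hω
  exact not_lt.mp hω

variable [TopologicalSpace Ω] [CompactSpace Ω] [BorelSpace Ω]

lemma integrable_of_continuous {μ : Measure Ω} [IsFiniteMeasure μ] {f : Ω → ℝ}
    (hf : Continuous f) : Integrable f μ :=
  (BoundedContinuousFunction.mkOfCompact ⟨f, hf⟩).integrable μ

/-- Some invariant measure maximizes the exponent, which is a uniform limit of continuous functions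
on the compact set of invariant probability measures. -/
lemma IsExponent.exists_isMaxOn [T2Space Ω] [SecondCountableTopology Ω]
    (hT : Continuous T)
    (hGc : ∀ n, Continuous (G n)) (hΛ : IsExponent T C G Λ)
    (hne : (invariantMeasures T).Nonempty) :
    ∃ μ ∈ invariantMeasures T, ∀ ν ∈ invariantMeasures T, Λ ν ≤ Λ μ := by
  let S : Set (ProbabilityMeasure Ω) := {P | P.map hT.measurable.aemeasurable = P}
  have hSmem : ∀ P : ProbabilityMeasure Ω, P ∈ S ↔ (P : Measure Ω) ∈ invariantMeasures T := by
    intro P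
    refine ⟨fun h => ⟨P.2, hT.measurable, congrArg Subtype.val h⟩, fun h => ?_⟩
    exact Subtype.ext h.2.map_eq
  have hS : IsClosed S := isClosed_eq (ProbabilityMeasure.continuous_map hT) continuous_id
  have hcont : ContinuousOn (fun P : ProbabilityMeasure Ω => Λ P) S := by
    have hu : TendstoUniformlyOn (fun (n : ℕ) (P : ProbabilityMeasure Ω) =>
        1 / (n : ℝ) * ∫ ω, G n ω ∂(P : Measure Ω)) (fun P => Λ P) atTop S := by
      rw [Metric.tendstoUniformlyOn_iff]
      intro ε hε
      obtain ⟨N, hN⟩ := exists_nat_gt (C / ε)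
      filter_upwards [eventually_ge_atTop (N + 1)] with n hn P hP
      have h1 := hΛ P ((hSmem P).mp hP) n
      have hn0 : (0 : ℝ) < n := by exact_mod_cast (Nat.succ_pos N).trans_le hn
      have hn1 : (N : ℝ) ≤ n := by exact_mod_cast (Nat.le_succ N).trans hn
      rw [div_lt_iff₀ hε] at hN
      have h2 : Λ P - 1 / (n : ℝ) * ∫ ω, G n ω ∂(P : Measure Ω) =
          -((∫ ω, G n ω ∂(P : Measure Ω) - n * Λ P) / n) := by
        field_simp
        ring
      rw [Real.dist_eq, h2, abs_neg, abs_div, abs_of_pos hn0, div_lt_iff₀ hn0]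
      nlinarith
    refine hu.continuousOn (Eventually.frequently (Eventually.of_forall fun n => ?_))
    exact (continuous_const.mul (ProbabilityMeasure.continuous_integral_boundedContinuousFunction
      (BoundedContinuousFunction.mkOfCompact ⟨G n, hGc n⟩))).continuousOn
  obtain ⟨μ₀, hμ₀⟩ := hne
  obtain ⟨P, hP, hmax⟩ := hS.isCompact.exists_isMaxOn ⟨⟨μ₀, hμ₀.1⟩, (hSmem _).mpr hμ₀⟩ hcont
  exact ⟨P, (hSmem P).mp hP, fun ν hν => hmax (a := ⟨ν, hν.1⟩) ((hSmem _).mpr hν)⟩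

/-- The union of the supports of the maximizing measures is itself the support of a maximizing
measure, namely of a countable convex combination in which every set of a countable basis that is
charged by some maximizing measure is charged. -/
lemma IsExponent.exists_support_eq_iUnion [SecondCountableTopology Ω] (hT : Continuous T)
    (hGc : ∀ n, Continuous (G n)) (hΛ : IsExponent T C G Λ)
    (hmax : ∀ ν ∈ invariantMeasures T, Λ ν ≤ β)
    (hne : {μ ∈ invariantMeasures T | Λ μ = β}.Nonempty) :
    ∃ μ ∈ {μ ∈ invariantMeasures T | Λ μ = β},
      ⋃ ν ∈ {μ ∈ invariantMeasures T | Λ μ = β}, ν.support = μ.support := by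
  set S : Set (Measure Ω) := {μ ∈ invariantMeasures T | Λ μ = β} with hS
  obtain ⟨μ₀, hμ₀⟩ := hne
  have hb := TopologicalSpace.isBasis_countableBasis Ω
  obtain ⟨f, hf⟩ := (TopologicalSpace.countable_countableBasis Ω).exists_eq_range (by
    have : Nonempty Ω := @nonempty_of_isProbabilityMeasure _ _ μ₀ hμ₀.1.1
    obtain ⟨u, hu, -⟩ := hb.exists_subset_of_mem_open (Set.mem_univ (Classical.arbitrary Ω))
      isOpen_univ
    exact ⟨u, hu⟩)
  have hex : ∀ n, ∃ ν ∈ S, (∃ ν' ∈ S, 0 < ν' (f n)) → 0 < ν (f n) := fun n => by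
    by_cases h : ∃ ν' ∈ S, 0 < ν' (f n)
    · obtain ⟨ν, hν, hpos⟩ := h
      exact ⟨ν, hν, fun _ => hpos⟩
    · exact ⟨μ₀, hμ₀, fun h' => absurd h' h⟩
  choose ν hνS hνpos using hex
  have hνp : ∀ n, IsProbabilityMeasure (ν n) := fun n => (hνS n).1.1
  set μ : Measure Ω := Measure.sum fun n => (2⁻¹ : ENNReal) ^ (n + 1) • ν n with hμ
  have hprob : IsProbabilityMeasure μ := ⟨by
    simp [hμ, Measure.sum_apply _ MeasurableSet.univ, ENNReal.tsum_geometric_add_one,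
      ENNReal.one_sub_inv_two,
      ENNReal.inv_mul_cancel]⟩
  have hinv : μ ∈ invariantMeasures T := by
    refine ⟨hprob, hT.measurable, ?_⟩
    rw [hμ, Measure.map_sum hT.measurable.aemeasurable]
    congr 1
    ext1 n
    rw [Measure.map_smul, (hνS n).1.2.map_eq]
  have hge : ∀ n : ℕ, n * β ≤ n * Λ μ + 2 * C := by
    intro n
    have h1 := (abs_le.mp (hΛ μ hinv n)).2
    have h2 : 0 ≤ ∫ ω, (G n ω - (n * β - C)) ∂μ := by
      have hi : Integrable (fun ω => G n ω - (n * β - C)) μ :=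
        integrable_of_continuous ((hGc n).sub continuous_const)
      rw [hμ] at hi ⊢
      rw [integral_sum_measure hi]
      refine tsum_nonneg fun j => ?_
      rw [integral_smul_measure]
      refine smul_nonneg ENNReal.toReal_nonneg ?_
      have h3 := (abs_le.mp (hΛ (ν j) (hνS j).1 n)).1
      rw [(hνS j).2] at h3
      rw [integral_sub (integrable_of_continuous (hGc n)) (integrable_const _)]
      simp only [integral_const, probReal_univ, smul_eq_mul, one_mul]
      linarith
    rw [integral_sub (integrable_of_continuous (hGc n)) (integrable_const _)] at h2
    simp only [integral_const, probReal_univ, smul_eq_mul, one_mul] at h2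
    linarith
  have hμS : μ ∈ S := ⟨hinv, le_antisymm (hmax μ hinv) (le_of_forall_nat_mul_le hge)⟩
  refine ⟨μ, hμS, subset_antisymm (Set.iUnion₂_subset fun ν' hν' x hx => ?_)
    (Set.subset_biUnion_of_mem (u := fun ν : Measure Ω => ν.support) hμS)⟩
  rw [Measure.mem_support_iff_forall] at hx ⊢
  intro U hU
  obtain ⟨V, hV, hxV, hVU⟩ := hb.mem_nhds_iff.mp hU
  obtain ⟨n, rfl⟩ : V ∈ Set.range f := hf ▸ hV
  have hpos := hνpos n ⟨ν', hν', hx _ ((hb.isOpen hV).mem_nhds hxV)⟩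
  calc 0 < (2⁻¹ : ENNReal) ^ (n + 1) * ν n (f n) :=
        ENNReal.mul_pos (pow_ne_zero _ (by simp)) hpos.ne'
    _ ≤ μ (f n) := (Measure.le_sum (fun n => (2⁻¹ : ENNReal) ^ (n + 1) • ν n) n) (f n)
    _ ≤ μ U := measure_mono hVU

lemma image_support_of_mem_invariantMeasures [T2Space Ω] [SecondCountableTopology Ω]
    (hT : Continuous T) {μ : Measure Ω} (hμ : μ ∈ invariantMeasures T) :
    T '' μ.support = μ.support := by
  have := hμ.1
  refine subset_antisymm ?_ ?_
  · rintro _ ⟨x, hx, rfl⟩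
    rw [Measure.mem_support_iff_forall] at hx ⊢
    intro U hU
    exact (hx _ (hT.continuousAt hU)).trans_le
      ((Measure.le_map_apply hT.measurable.aemeasurable U).trans_eq (by rw [hμ.2.map_eq]))
  · have hcl : IsClosed (T '' μ.support) :=
      (Measure.isClosed_support.isCompact.image hT).isClosed
    refine Measure.support_subset_of_isClosed hcl ?_
    have h1 : T ⁻¹' (T '' μ.support) ∈ ae μ :=
      mem_of_superset Measure.support_mem_ae (Set.subset_preimage_image _ _)
    have h2 : T '' μ.support ∈ ae (μ.map T) :=
      (mem_ae_map_iff hT.measurable.aemeasurable hcl.measurableSet).mpr h1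
    rwa [hμ.2.map_eq] at h2

/-- Ergodic optimization of an almost additive sequence of continuous functions, for a system whose
orbit segments are shadowed by periodic orbits: the union of the supports of the maximizing measures
is nonempty, compact and invariant, and supports only maximizing measures. -/
theorem IsExponent.iUnion_support [T2Space Ω] [SecondCountableTopology Ω] [Nonempty Ω]
    (hT : Continuous T) (hG : IsAlmostAdditive T C G) (hGc : ∀ n, Continuous (G n))
    (hΛ : IsExponent T C G Λ)
    (hper : ∀ n, 0 < n → ∀ ω, ∃ p, Function.IsPeriodicPt T n p ∧ G n p = G n ω)
    {K : Set Ω} (hβ : β = sSup (Λ '' invariantMeasures T))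
    (hK : K = ⋃ ν ∈ {μ ∈ invariantMeasures T | Λ μ = β}, ν.support) :
    K.Nonempty ∧ IsCompact K ∧ T '' K = K ∧
      ∀ μ ∈ invariantMeasures T, μ.support ⊆ K → Λ μ = β := by
  have hm : ∀ n, Measurable (G n) := fun n => (hGc n).measurable
  have hne : (invariantMeasures T).Nonempty := by
    obtain ⟨p, hp, -⟩ := hper 1 one_pos (Classical.arbitrary Ω)
    obtain ⟨μ, hμ, -⟩ := hΛ.exists_ge_of_isPeriodicPt hT.measurable hG hm one_pos hp
    exact ⟨μ, hμ⟩
  obtain ⟨μ₀, hμ₀, hmax⟩ := hΛ.exists_isMaxOn hT hGc hne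
  have hgreatest : IsGreatest (Λ '' invariantMeasures T) (Λ μ₀) :=
    ⟨⟨μ₀, hμ₀, rfl⟩, by rintro _ ⟨ν, hν, rfl⟩; exact hmax ν hν⟩
  have hβ₀ : Λ μ₀ = β := by rw [hβ, hgreatest.csSup_eq]
  rw [hβ₀] at hmax
  obtain ⟨μ, hμ, hsupp⟩ := hΛ.exists_support_eq_iUnion hT hGc hmax ⟨μ₀, hμ₀, hβ₀⟩
  rw [hsupp] at hK
  have := hμ.1.1
  have hC := hG.nonneg
  have hup : ∀ n ω, G n ω ≤ n * β + C := by
    intro n ω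
    rcases Nat.eq_zero_or_pos n with rfl | hn
    · have := (abs_le.mp (hG 0 0 ω)).1
      simp only [add_zero, Function.iterate_zero, id_eq, sub_self, zero_sub] at this
      simp only [Nat.cast_zero, zero_mul]
      linarith
    · obtain ⟨p, hp, hpω⟩ := hper n hn ω
      obtain ⟨ν, hν, hle⟩ := hΛ.exists_ge_of_isPeriodicPt hT.measurable hG hm hn hp
      rw [← hpω]
      have := hmax ν hν
      have : n * Λ ν ≤ n * β := by gcongr
      linarith
  have hlow : ∀ n, ∀ ω ∈ K, n * β - (3 * C + 1) ≤ G n ω := by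
    intro n
    rw [hK]
    exact Measure.support_subset_of_isClosed (isClosed_le continuous_const (hGc n))
      (hG.ae_ge_of_exponent_eq hμ.1 hm (fun n => integrable_of_continuous (hGc n)) hΛ hup hμ.2 n)
  refine ⟨?_, ?_, ?_, ?_⟩
  · rw [hK]
    exact nonempty_of_mem (Measure.support_mem_ae (μ := μ))
  · rw [hK]
    exact Measure.isClosed_support.isCompact
  · rw [hK]
    exact image_support_of_mem_invariantMeasures hT hμ.1
  · intro ν hν hνK
    have := hν.1
    refine le_antisymm (hmax ν hν) (le_of_forall_nat_mul_le (D := 3 * C + 1 + C) fun n => ?_)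
    have h1 : ∫ _, (n * β - (3 * C + 1)) ∂ν ≤ ∫ ω, G n ω ∂ν :=
      integral_mono_ae (integrable_const _) (integrable_of_continuous (hGc n)) (by
        filter_upwards [Measure.support_mem_ae (μ := ν)] with ω hω
        exact hlow n ω (hνK hω))
    have h2 := (abs_le.mp (hΛ ν hν n)).2
    simp only [integral_const, probReal_univ, smul_eq_mul, one_mul] at h1
    linarith

end Optimization

/-! ### Almost additivity of the norms of a dominated cocycle -/

section Domination

lemma toMap_mul (g h : GL (Fin 2) ℝ) : toMap (g * h) = (toMap g).comp (toMap h) := by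
  simp only [toMap, Units.val_mul, map_mul]
  rfl

lemma toMap_one : toMap 1 = ContinuousLinearMap.id ℝ Plane := by
  simp only [toMap, Units.val_one, map_one]
  rfl

lemma toMap_inv_apply (g : GL (Fin 2) ℝ) (x : Plane) : toMap g⁻¹ (toMap g x) = x := by
  rw [← ContinuousLinearMap.comp_apply, ← toMap_mul, inv_mul_cancel, toMap_one,
    ContinuousLinearMap.id_apply]

lemma norm_toMap_one : ‖toMap 1‖ = 1 := by
  rw [toMap_one, ContinuousLinearMap.norm_id]

lemma norm_toMap_mul_le (g h : GL (Fin 2) ℝ) : ‖toMap (g * h)‖ ≤ ‖toMap g‖ * ‖toMap h‖ := by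
  rw [toMap_mul]
  exact ContinuousLinearMap.opNorm_comp_le _ _

lemma norm_toMap_pos (g : GL (Fin 2) ℝ) : 0 < ‖toMap g‖ := by
  by_contra h
  have h0 : ‖toMap g‖ = 0 := le_antisymm (not_lt.mp h) (norm_nonneg _)
  have := norm_toMap_mul_le g g⁻¹
  rw [mul_inv_cancel, norm_toMap_one, h0, zero_mul] at this
  linarith

lemma norm_apply_eq_of_finrank_eq_one {e : Submodule ℝ Plane} (he : Module.finrank ℝ e = 1)
    (L : Plane →L[ℝ] Plane) {x : Plane} (hx : x ∈ e) : ‖L x‖ = ‖L.comp e.subtypeL‖ * ‖x‖ := by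
  rcases eq_or_ne x 0 with rfl | hx0
  · simp
  have hpos : 0 < ‖x‖ := norm_pos_iff.mpr hx0
  refine le_antisymm ((L.comp e.subtypeL).le_opNorm ⟨x, hx⟩) ?_
  rw [← le_div_iff₀ hpos]
  refine ContinuousLinearMap.opNorm_le_bound _ (by positivity) fun y => ?_
  have hx0' : (⟨x, hx⟩ : e) ≠ 0 := fun h => hx0 (congrArg Subtype.val h)
  obtain ⟨a, rfl⟩ := (finrank_eq_one_iff_of_nonzero' _ hx0').mp he y
  simp only [ContinuousLinearMap.comp_apply, map_smul, Submodule.subtypeL_apply, norm_smul,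
    Submodule.coe_norm]
  rw [div_mul_eq_mul_div, le_div_iff₀ hpos]
  exact le_of_eq (by ring)

variable {Ω : Type*} {T : Ω → Ω} {A : Ω → GL (Fin 2) ℝ} {e₁ e₂ : Ω → Submodule ℝ Plane}

lemma iterate_add (m n : ℕ) (ω : Ω) :
    iterate T A (m + n) ω = iterate T A n (T^[m] ω) * iterate T A m ω := by
  induction n with
  | zero => simp [iterate]
  | succ n ih =>
    rw [← add_assoc, iterate, ih, iterate, ← Function.iterate_add_apply, add_comm n m, mul_assoc]

lemma norm_iterate_le {R : ℝ} (hR : ∀ ω, ‖toMap (A ω)‖ ≤ R) (n : ℕ) (ω : Ω) :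
    ‖toMap (iterate T A n ω)‖ ≤ R ^ n := by
  induction n with
  | zero => simp [iterate, norm_toMap_one]
  | succ n ih =>
    rw [iterate, pow_succ']
    exact (norm_toMap_mul_le _ _).trans
      (mul_le_mul (hR _) ih (norm_nonneg _) ((norm_nonneg _).trans (hR ω)))

lemma norm_iterate_inv_le {R : ℝ} (hR : ∀ ω, ‖toMap (A ω)⁻¹‖ ≤ R) (n : ℕ) (ω : Ω) :
    ‖toMap (iterate T A n ω)⁻¹‖ ≤ R ^ n := by
  induction n with
  | zero => simp [iterate, norm_toMap_one]
  | succ n ih =>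
    rw [iterate, pow_succ, mul_inv_rev]
    exact (norm_toMap_mul_le _ _).trans
      (mul_le_mul ih (hR _) (norm_nonneg _) (pow_nonneg ((norm_nonneg _).trans (hR ω)) _))

namespace IsDominatedSplitting

lemma iterate_apply_mem_fst (h : IsDominatedSplitting T A e₁ e₂) (n : ℕ) (ω : Ω) {x : Plane}
    (hx : x ∈ e₁ ω) : toMap (iterate T A n ω) x ∈ e₁ (T^[n] ω) := by
  induction n with
  | zero => simpa [iterate, toMap_one] using hx
  | succ n ih =>
    rw [iterate, toMap_mul, Function.iterate_succ_apply', ← h.map_fst]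
    exact Submodule.mem_map_of_mem ih

lemma norm_restrict_fst_add (h : IsDominatedSplitting T A e₁ e₂) (m n : ℕ) (ω : Ω) :
    ‖(toMap (iterate T A (m + n) ω)).comp (e₁ ω).subtypeL‖ =
      ‖(toMap (iterate T A n (T^[m] ω))).comp (e₁ (T^[m] ω)).subtypeL‖ *
        ‖(toMap (iterate T A m ω)).comp (e₁ ω).subtypeL‖ := by
  obtain ⟨⟨x, hx⟩, hx0, -⟩ := finrank_eq_one_iff'.mp (h.finrank_fst ω)
  have hpos : 0 < ‖x‖ := norm_pos_iff.mpr fun h0 => hx0 (Subtype.ext h0)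
  refine mul_right_cancel₀ hpos.ne' ?_
  rw [← norm_apply_eq_of_finrank_eq_one (h.finrank_fst ω) _ hx, iterate_add, toMap_mul,
    ContinuousLinearMap.comp_apply, norm_apply_eq_of_finrank_eq_one (h.finrank_fst (T^[m] ω)) _
    (h.iterate_apply_mem_fst m ω hx), norm_apply_eq_of_finrank_eq_one (h.finrank_fst ω) _ hx,
    mul_assoc]

/-- The angle between the two lines of a dominated splitting is bounded below: if `x₁` and `-x₂` were
nearly equal, then a fixed iterate of the cocycle would expand them by nearly the same factor. -/
lemma exists_norm_fst_le (h : IsDominatedSplitting T A e₁ e₂) {R : ℝ} (hR0 : 0 ≤ R)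
    (hR : ∀ ω, ‖toMap (A ω)‖ ≤ R) (hR' : ∀ ω, ‖toMap (A ω)⁻¹‖ ≤ R) :
    ∃ D, 0 ≤ D ∧ ∀ ω, ∀ x₁ ∈ e₁ ω, ∀ x₂ ∈ e₂ ω, ‖x₁‖ ≤ D * ‖x₁ + x₂‖ := by
  obtain ⟨c, hc, δ, hδ, hdom⟩ := h.dominance
  obtain ⟨N, hN⟩ := exists_nat_gt (max 1 (2 / (c * δ)))
  have hN1 : 1 ≤ N := by exact_mod_cast (le_max_left _ _).trans hN.le
  have hN2 : 2 ≤ c * Real.exp (δ * N) := by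
    have h1 := (le_max_right _ _).trans_lt hN
    rw [div_lt_iff₀ (by positivity)] at h1
    have h2 := Real.add_one_le_exp (δ * N)
    nlinarith
  refine ⟨R ^ N * (3 * R ^ N), by positivity, fun ω x₁ hx₁ x₂ hx₂ => ?_⟩
  rcases eq_or_ne x₁ 0 with rfl | hx0
  · rw [norm_zero]
    positivity
  have hpos : 0 < ‖x₁‖ := norm_pos_iff.mpr hx0
  set L := toMap (iterate T A N ω) with hL
  set p₁ := ‖L.comp (e₁ ω).subtypeL‖ with hp₁
  set p₂ := ‖L.comp (e₂ ω).subtypeL‖ with hp₂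
  have hp₁0 : 0 ≤ p₁ := norm_nonneg (L.comp (e₁ ω).subtypeL)
  have hdomN : 2 * p₂ ≤ p₁ := by
    rcases (norm_nonneg (L.comp (e₂ ω).subtypeL)).eq_or_lt with h0 | h0
    · rw [hp₂, ← h0, mul_zero]
      exact hp₁0
    · exact (le_div_iff₀ h0).mp (hN2.trans (hdom ω N hN1))
  have h1 : ‖L x₁‖ = p₁ * ‖x₁‖ := norm_apply_eq_of_finrank_eq_one (h.finrank_fst ω) L hx₁
  have h2 : ‖L x₂‖ = p₂ * ‖x₂‖ := norm_apply_eq_of_finrank_eq_one (h.finrank_snd ω) L hx₂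
  have h3 : ‖x₂‖ ≤ ‖x₁‖ + ‖x₁ + x₂‖ := by
    have := norm_sub_le (x₁ + x₂) x₁
    rw [add_sub_cancel_left] at this
    linarith
  have hLR : ∀ z, ‖L z‖ ≤ R ^ N * ‖z‖ := fun z =>
    (L.le_opNorm z).trans (mul_le_mul_of_nonneg_right (norm_iterate_le hR N ω) (norm_nonneg z))
  have h4 : ‖L x₁‖ ≤ ‖L x₂‖ + R ^ N * ‖x₁ + x₂‖ := by
    have h5 := norm_sub_le (L (x₁ + x₂)) (L x₂)
    rw [map_add, add_sub_cancel_right, ← map_add] at h5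
    linarith [hLR (x₁ + x₂)]
  have h5 : ‖x₁‖ ≤ R ^ N * ‖L x₁‖ := by
    have h6 := (toMap (iterate T A N ω)⁻¹).le_opNorm (L x₁)
    rw [toMap_inv_apply] at h6
    exact h6.trans (mul_le_mul_of_nonneg_right (norm_iterate_inv_le hR' N ω) (norm_nonneg _))
  have h6 : p₁ ≤ R ^ N := le_of_mul_le_mul_right (h1 ▸ hLR x₁) hpos
  have h7 : ‖L x₁‖ ≤ 3 * R ^ N * ‖x₁ + x₂‖ := by
    have h8 : 2 * (p₂ * ‖x₂‖) ≤ p₁ * (‖x₁‖ + ‖x₁ + x₂‖) := by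
      rw [← mul_assoc]
      exact mul_le_mul hdomN h3 (norm_nonneg _) hp₁0
    have h9 : p₁ * ‖x₁ + x₂‖ ≤ R ^ N * ‖x₁ + x₂‖ :=
      mul_le_mul_of_nonneg_right h6 (norm_nonneg _)
    linarith
  calc ‖x₁‖ ≤ R ^ N * ‖L x₁‖ := h5
    _ ≤ R ^ N * (3 * R ^ N * ‖x₁ + x₂‖) := by gcongr
    _ = R ^ N * (3 * R ^ N) * ‖x₁ + x₂‖ := by ring

/-- The norm of the products is comparable to the norm of their restrictions to the dominating
line. -/
lemma exists_norm_iterate_le (h : IsDominatedSplitting T A e₁ e₂) {R : ℝ} (hR0 : 0 ≤ R)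
    (hR : ∀ ω, ‖toMap (A ω)‖ ≤ R) (hR' : ∀ ω, ‖toMap (A ω)⁻¹‖ ≤ R) :
    ∃ κ, 1 ≤ κ ∧ ∀ ω n, 1 ≤ n → ‖toMap (iterate T A n ω)‖ ≤
      κ * ‖(toMap (iterate T A n ω)).comp (e₁ ω).subtypeL‖ := by
  obtain ⟨D, hD0, hD⟩ := h.exists_norm_fst_le hR0 hR hR'
  obtain ⟨c, hc, δ, hδ, hdom⟩ := h.dominance
  refine ⟨max 1 (D + c⁻¹ * (D + 1)), le_max_left _ _, fun ω n hn => ?_⟩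
  set L := toMap (iterate T A n ω) with hL
  set p₁ := ‖L.comp (e₁ ω).subtypeL‖ with hp₁
  set p₂ := ‖L.comp (e₂ ω).subtypeL‖ with hp₂
  have hp₁0 : 0 ≤ p₁ := norm_nonneg (L.comp (e₁ ω).subtypeL)
  have hp : p₂ ≤ c⁻¹ * p₁ := by
    rw [inv_mul_eq_div, le_div_iff₀ hc, mul_comm]
    rcases (norm_nonneg (L.comp (e₂ ω).subtypeL)).eq_or_lt with h0 | h0
    · rw [hp₂, ← h0, mul_zero]
      exact hp₁0
    · refine (le_div_iff₀ h0).mp (le_trans ?_ (hdom ω n hn))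
      exact le_mul_of_one_le_right hc.le (Real.one_le_exp (by positivity))
  refine (L.opNorm_le_bound (M := (D + c⁻¹ * (D + 1)) * p₁) (by positivity) fun y => ?_).trans
    (mul_le_mul_of_nonneg_right (le_max_right _ _) hp₁0)
  obtain ⟨x₁, hx₁, x₂, hx₂, rfl⟩ :=
    Submodule.mem_sup.mp ((h.isCompl ω).sup_eq_top ▸ Submodule.mem_top : y ∈ e₁ ω ⊔ e₂ ω)
  have h1 : ‖L x₁‖ = p₁ * ‖x₁‖ := norm_apply_eq_of_finrank_eq_one (h.finrank_fst ω) L hx₁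
  have h2 : ‖L x₂‖ = p₂ * ‖x₂‖ := norm_apply_eq_of_finrank_eq_one (h.finrank_snd ω) L hx₂
  have h3 := hD ω x₁ hx₁ x₂ hx₂
  have h4 : ‖x₂‖ ≤ (D + 1) * ‖x₁ + x₂‖ := by
    have := norm_sub_le (x₁ + x₂) x₁
    rw [add_sub_cancel_left] at this
    linarith
  calc ‖L (x₁ + x₂)‖ ≤ p₁ * ‖x₁‖ + p₂ * ‖x₂‖ := by
        rw [map_add, ← h1, ← h2]
        exact norm_add_le _ _
    _ ≤ p₁ * (D * ‖x₁ + x₂‖) + c⁻¹ * p₁ * ((D + 1) * ‖x₁ + x₂‖) := by gcongr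
    _ = (D + c⁻¹ * (D + 1)) * p₁ * ‖x₁ + x₂‖ := by ring

/-- The logarithms of the norms of the products of a dominated cocycle are almost additive: up to
constants, the norms are those of the restrictions to the dominating line, which are
multiplicative. -/
theorem exists_isAlmostAdditive (h : IsDominatedSplitting T A e₁ e₂) {R : ℝ} (hR0 : 0 ≤ R)
    (hR : ∀ ω, ‖toMap (A ω)‖ ≤ R) (hR' : ∀ ω, ‖toMap (A ω)⁻¹‖ ≤ R) :
    ∃ C, IsAlmostAdditive T C fun n ω => Real.log ‖toMap (iterate T A n ω)‖ := by
  obtain ⟨κ, hκ, hle⟩ := h.exists_norm_iterate_le hR0 hR hR'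
  have hκ0 : 0 < κ := by linarith
  have hlog : 0 ≤ 2 * Real.log κ := mul_nonneg zero_le_two (Real.log_nonneg hκ)
  refine ⟨2 * Real.log κ, fun m n ω => ?_⟩
  rcases Nat.eq_zero_or_pos m with rfl | hm
  · simpa [iterate, norm_toMap_one] using hlog
  rcases Nat.eq_zero_or_pos n with rfl | hn
  · simpa [iterate, norm_toMap_one] using hlog
  have h0 := norm_toMap_pos (iterate T A (m + n) ω)
  have h1 := norm_toMap_pos (iterate T A m ω)
  have h2 := norm_toMap_pos (iterate T A n (T^[m] ω))
  have hupper : ‖toMap (iterate T A (m + n) ω)‖ ≤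
      ‖toMap (iterate T A n (T^[m] ω))‖ * ‖toMap (iterate T A m ω)‖ := by
    rw [iterate_add]
    exact norm_toMap_mul_le _ _
  have hlower : ‖toMap (iterate T A n (T^[m] ω))‖ * ‖toMap (iterate T A m ω)‖ ≤
      κ ^ 2 * ‖toMap (iterate T A (m + n) ω)‖ := by
    have hsub : ‖(toMap (iterate T A (m + n) ω)).comp (e₁ ω).subtypeL‖ ≤
        ‖toMap (iterate T A (m + n) ω)‖ :=
      (ContinuousLinearMap.opNorm_comp_le _ _).trans
        (mul_le_of_le_one_right (norm_nonneg _) (Submodule.norm_subtypeL_le _))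
    calc _ ≤ (κ * ‖(toMap (iterate T A n (T^[m] ω))).comp (e₁ (T^[m] ω)).subtypeL‖) *
          (κ * ‖(toMap (iterate T A m ω)).comp (e₁ ω).subtypeL‖) :=
          mul_le_mul (hle _ n hn) (hle _ m hm) (norm_nonneg _) (by positivity)
      _ = κ ^ 2 * ‖(toMap (iterate T A (m + n) ω)).comp (e₁ ω).subtypeL‖ := by
          rw [h.norm_restrict_fst_add]
          ring
      _ ≤ _ := by gcongr
  have h3 := Real.log_le_log h0 hupper
  have h4 := Real.log_le_log (mul_pos h2 h1) hlower
  rw [Real.log_mul h2.ne' h1.ne'] at h3 h4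
  rw [Real.log_mul (by positivity) h0.ne', Real.log_pow] at h4
  push_cast at h4
  rw [abs_le]
  constructor <;> linarith

end IsDominatedSplitting

end Domination

/-! ### The full shift -/

section Shift

variable {k : ℕ}

lemma continuous_shift : Continuous (shift (k := k)) :=
  continuous_pi fun i => continuous_apply (i + 1)

lemma shift_iterate_apply (n : ℕ) (ω : Words k) (i : ℤ) : shift^[n] ω i = ω (i + n) := by
  induction n generalizing ω with
  | zero => simp
  | succ n ih =>
    rw [Function.iterate_succ_apply, ih, shift]
    congr 1
    push_cast
    ring

lemma isLocallyConstant_iterate (A : Fin k → GL (Fin 2) ℝ) (n : ℕ) :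
    IsLocallyConstant (iterate shift (oneStep A) n) := by
  induction n with
  | zero => exact IsLocallyConstant.const 1
  | succ n ih =>
    have h1 : Continuous fun ω : Words k => shift^[n] ω 0 :=
      (continuous_apply 0).comp (continuous_shift.iterate n)
    exact (((IsLocallyConstant.iff_continuous _).mpr h1).comp A).mul ih

lemma iterate_congr (A : Fin k → GL (Fin 2) ℝ) {n : ℕ} {ω ω' : Words k}
    (h : ∀ i : ℕ, i < n → ω i = ω' i) :
    iterate shift (oneStep A) n ω = iterate shift (oneStep A) n ω' := by
  induction n with
  | zero => rfl
  | succ n ih =>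
    rw [iterate, iterate, ih fun i hi => h i (hi.trans (Nat.lt_succ_self n)), oneStep, oneStep,
      shift_iterate_apply, shift_iterate_apply, zero_add, h n (Nat.lt_succ_self n)]

/-- Every word has a periodic word with the same matrix product of length `n`. -/
lemma exists_isPeriodicPt_iterate_eq (A : Fin k → GL (Fin 2) ℝ) {n : ℕ} (ω : Words k) :
    ∃ p, Function.IsPeriodicPt shift n p ∧
      iterate shift (oneStep A) n p = iterate shift (oneStep A) n ω := by
  refine ⟨fun i => ω (i % n), ?_, iterate_congr A fun i hi => ?_⟩
  · ext1 i
    rw [shift_iterate_apply, Int.add_emod_right]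
  · rw [Int.emod_eq_of_lt (by positivity) (by exact_mod_cast hi)]

end Shift

end MatrixCocycle

open MatrixCocycle in
theorem theoremA (k : ℕ) (hk : 2 ≤ k) (A : Fin k → GL (Fin 2) ℝ)
    (hA : MatrixCocycle.IsDominated MatrixCocycle.shift (MatrixCocycle.oneStep A)) :
    ((MatrixCocycle.upperMatherSet MatrixCocycle.shift (MatrixCocycle.oneStep A)).Nonempty ∧
      IsCompact (MatrixCocycle.upperMatherSet MatrixCocycle.shift (MatrixCocycle.oneStep A)) ∧
      MatrixCocycle.shift ''
          MatrixCocycle.upperMatherSet MatrixCocycle.shift (MatrixCocycle.oneStep A) =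
        MatrixCocycle.upperMatherSet MatrixCocycle.shift (MatrixCocycle.oneStep A) ∧
      ∀ μ ∈ MatrixCocycle.invariantMeasures (MatrixCocycle.shift (k := k)),
        μ.support ⊆ MatrixCocycle.upperMatherSet MatrixCocycle.shift (MatrixCocycle.oneStep A) →
        MatrixCocycle.lyapunov MatrixCocycle.shift (MatrixCocycle.oneStep A) μ =
          MatrixCocycle.topLyapunov MatrixCocycle.shift (MatrixCocycle.oneStep A)) ∧
    ((MatrixCocycle.lowerMatherSet MatrixCocycle.shift (MatrixCocycle.oneStep A)).Nonempty ∧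
      IsCompact (MatrixCocycle.lowerMatherSet MatrixCocycle.shift (MatrixCocycle.oneStep A)) ∧
      MatrixCocycle.shift ''
          MatrixCocycle.lowerMatherSet MatrixCocycle.shift (MatrixCocycle.oneStep A) =
        MatrixCocycle.lowerMatherSet MatrixCocycle.shift (MatrixCocycle.oneStep A) ∧
      ∀ μ ∈ MatrixCocycle.invariantMeasures (MatrixCocycle.shift (k := k)),
        μ.support ⊆ MatrixCocycle.lowerMatherSet MatrixCocycle.shift (MatrixCocycle.oneStep A) →
        MatrixCocycle.lyapunov MatrixCocycle.shift (MatrixCocycle.oneStep A) μ =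
          MatrixCocycle.botLyapunov MatrixCocycle.shift (MatrixCocycle.oneStep A)) := by
  have : Nonempty (Words k) := ⟨fun _ => ⟨0, by lia⟩⟩
  obtain ⟨e₁, e₂, h⟩ := hA
  set G : ℕ → Words k → ℝ := fun n ω => Real.log ‖toMap (iterate shift (oneStep A) n ω)‖ with hGdef
  have hGc : ∀ n, Continuous (G n) := fun n =>
    ((isLocallyConstant_iterate A n).comp fun g => Real.log ‖toMap g‖).continuous
  have hper : ∀ n, 0 < n → ∀ ω, ∃ p, Function.IsPeriodicPt shift n p ∧ G n p = G n ω := by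
    intro n _ ω
    obtain ⟨p, hp, hpω⟩ := exists_isPeriodicPt_iterate_eq A (n := n) ω
    exact ⟨p, hp, by simp only [hGdef, hpω]⟩
  set R : ℝ := ∑ j, (‖toMap (A j)‖ + ‖toMap (A j)⁻¹‖) with hRdef
  have hRj : ∀ j, ‖toMap (A j)‖ + ‖toMap (A j)⁻¹‖ ≤ R := fun j =>
    Finset.single_le_sum (f := fun j => ‖toMap (A j)‖ + ‖toMap (A j)⁻¹‖)
      (fun _ _ => by positivity) (Finset.mem_univ j)
  obtain ⟨C, hG⟩ := h.exists_isAlmostAdditive (R := R) (by positivity)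
    (fun ω => (le_add_of_nonneg_right (norm_nonneg _)).trans (hRj (ω 0)))
    (fun ω => (le_add_of_nonneg_left (norm_nonneg _)).trans (hRj (ω 0)))
  obtain ⟨B, hB⟩ := isCompact_univ.exists_bound_of_continuousOn (hGc 1).continuousOn
  have hΛ : IsExponent shift C G (lyapunov shift (oneStep A)) := fun μ hμ n => by
    have := hμ.1
    exact hG.abs_integral_sub_le hμ.1 hμ.2 (fun ω => hB ω (Set.mem_univ ω))
      (fun n => (hGc n).measurable) n
  refine ⟨hΛ.iUnion_support continuous_shift hG hGc hper rfl rfl, ?_⟩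
  -- The minimizing measures are the maximizing measures of the negated sequence.
  have hneg : -botLyapunov shift (oneStep A) =
      sSup ((fun μ => -lyapunov shift (oneStep A) μ) '' invariantMeasures shift) := by
    rw [botLyapunov, Real.sInf_def, neg_neg, ← Set.image_neg_eq_neg, Set.image_image]
  have hbot := hΛ.neg.iUnion_support (K := lowerMatherSet shift (oneStep A)) continuous_shift
    hG.neg (fun n => (hGc n).neg)
    (fun n hn ω => (hper n hn ω).imp fun p hp => ⟨hp.1, congrArg Neg.neg hp.2⟩) hneg
    (by simp only [lowerMatherSet, neg_inj])
  simpa only [neg_inj] using hbot
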